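/- Let $\mathbb K=\mathbb R$ or $\mathbb C$, let $m\ge 1$, and let $\omega(u,v)=\sum_{i=1}^m u_iv_{i+m}-\sum_{i=1}^m u_{i+m}v_i$ be the standard symplectic bilinear form on $\mathbb K^{2m}$, with automorphism group $\mathsf{Sp}_{2m}(\mathbb K)$. Let $\mathsf S^1(\mathbb K^{2m})$ be the unit sphere for the standard Hermitian inner product, and let $\sigma_1(g)\ge\sigma_2(g)\ge\dots\ge\sigma_{2m}(g)$ be the singular values of a matrix $g$. Let $\Gamma$ be a non-elementary word hyperbolic group (i.e. not virtually cyclic), with word length $|\cdot|_\Gamma$ for a finite generating set and Gromov boundary $\partial_\infty\Gamma$, and let $w_0\in\partial_\infty\Gamma$. Let $\rho:\Gamma\to\mathsf{Sp}_{2m}(\mathbb K)$ be a $1$-Anosov representation, i.e. a homomorphism for which there are $c,\mu>0$ with $\sigma_1(\rho(\gamma))/\sigma_2(\rho(\gamma))\ge c\,e^{\mu|\gamma|_\Gamma}$ for all $\gamma\in\Gamma$. Let $\xi^1_\rho:\partial_\infty\Gamma\to\mathbb P(\mathbb K^{2m})$ be its Anosov limit map, i.e. the continuous $\rho$-equivariant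 map such that, for every geodesic ray $(\gamma_n)$ in the Cayley graph of $\Gamma$ with endpoint $x$, $\xi^1_\rho(x)$ is the limit of the lines spanned by the largest semi-axes of the ellipsoids $\rho(\gamma_n)\mathsf S^1(\mathbb K^{2m})$. Then there exists a continuous map $\widetilde\xi^1_\rho:\partial_\infty\Gamma\smallsetminus\{w_0\}\to\mathsf S^1(\mathbb K^{2m})$ that lifts the restriction of $\xi^1_\rho$, i.e. $\xi^1_\rho(x)=[\widetilde\xi^1_\rho(x)]$ for all $x\ne w_0$, and such that for every pair of distinct points $x,y\in\partial_\infty\Gamma\smallsetminus\{w_0\}$, $$\omega\big(\widetilde\xi^1_\rho(x),\widetilde\xi^1_\rho(y)\big)\ne 0.$$ -/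

import Mathlib

open Filter Topology
open scoped LinearAlgebra.Projectivization

noncomputable section

namespace AnosovSymplectic

/-! ### Word metrics, hyperbolicity -/

section WordMetric

variable {Γ : Type*} [Group Γ]

/-- The left-invariant word metric of `Γ` with respect to `S`: the path metric on the vertices of
the Cayley graph of `Γ` with respect to `S`. -/
def wordDist (S : Set Γ) (g h : Γ) : ℕ := (SimpleGraph.mulCayley S).dist g h

/-- The word length `|γ|`, the distance of `γ` from the identity. -/
def wordLength (S : Set Γ) (g : Γ) : ℕ := wordDist S 1 g

/-- The Gromov product `(x | y)_w` for the word metric. -/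
def gromovProduct (S : Set Γ) (w x y : Γ) : ℝ :=
  ((wordDist S w x : ℝ) + wordDist S w y - wordDist S x y) / 2

/-- `S` is a finite generating set of `Γ` whose word metric is Gromov hyperbolic
(four-point condition), i.e. `Γ` is a word hyperbolic group, equipped with the word metric
of `S`. -/
structure IsWordHyperbolic (S : Set Γ) : Prop where
  finite : S.Finite
  closure_eq_top : Subgroup.closure S = ⊤
  hyperbolic : ∃ δ : ℝ, ∀ w x y z : Γ,
    min (gromovProduct S w x y) (gromovProduct S w y z) - δ ≤ gromovProduct S w x z

variable (Γ) in
/-- A group is elementary if it is finite or virtually infinite cyclic, i.e. if it has a cyclic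
subgroup (possibly trivial) of finite index. -/
def IsElementary : Prop := ∃ H : Subgroup Γ, IsCyclic H ∧ H.FiniteIndex

/-! ### The Gromov boundary -/

/-- Geodesic rays in (the vertex set of) the Cayley graph, starting at an arbitrary point. -/
def GeodesicRay (S : Set Γ) : Type _ :=
  {r : ℕ → Γ // ∀ n k : ℕ, wordDist S (r n) (r (n + k)) = k}

/-- Two geodesic rays are asymptotic if they stay at bounded distance from each other.
(We use the `ℕ∞`-valued distance of the Cayley graph, which agrees with `wordDist` when `S`
generates `Γ`.) -/
def asymptotic (S : Set Γ) : Setoid (GeodesicRay S) where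
  r r₁ r₂ := ∃ C : ℕ, ∀ n, (SimpleGraph.mulCayley S).edist (r₁.1 n) (r₂.1 n) ≤ C
  iseqv :=
    { refl := fun r => ⟨0, fun n => by simp⟩
      symm := by
        rintro r₁ r₂ ⟨C, hC⟩
        exact ⟨C, fun n => by rw [SimpleGraph.edist_comm]; exact hC n⟩
      trans := by
        rintro r₁ r₂ r₃ ⟨C, hC⟩ ⟨D, hD⟩
        refine ⟨C + D, fun n => ?_⟩
        push_cast
        exact SimpleGraph.edist_triangle.trans (add_le_add (hC n) (hD n)) }

/-- The Gromov boundary: geodesic rays modulo being asymptotic. -/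
def Boundary (S : Set Γ) : Type _ := Quotient (asymptotic S)

/-- The endpoint at infinity of a geodesic ray. -/
def endpoint {S : Set Γ} (r : GeodesicRay S) : Boundary S := Quotient.mk (asymptotic S) r

/-- Rays carry the topology of uniform convergence on bounded sets, i.e. of pointwise convergence
for the discrete topology on `Γ`. -/
instance (S : Set Γ) : TopologicalSpace (GeodesicRay S) :=
  TopologicalSpace.induced (fun r => r.1) (@Pi.topologicalSpace ℕ (fun _ => Γ) (fun _ => ⊥))

/-- The topology of the Gromov boundary: the quotient of the topology of uniform convergence of
geodesic rays on bounded sets. -/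
instance (S : Set Γ) : TopologicalSpace (Boundary S) :=
  TopologicalSpace.coinduced endpoint inferInstance

/-- Left translations are automorphisms of the Cayley graph. -/
def leftIso (S : Set Γ) (g : Γ) : SimpleGraph.mulCayley S ≃g SimpleGraph.mulCayley S where
  toEquiv := Equiv.mulLeft g
  map_rel_iff' := by
    intro a b
    simp [SimpleGraph.mulCayley_adj', mul_assoc]

theorem edist_mul_left (S : Set Γ) (g a b : Γ) :
    (SimpleGraph.mulCayley S).edist (g * a) (g * b) = (SimpleGraph.mulCayley S).edist a b := by
  have key : ∀ (g a b : Γ), (SimpleGraph.mulCayley S).edist (g * a) (g * b)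
      ≤ (SimpleGraph.mulCayley S).edist a b := by
    intro g a b
    refine le_iInf fun w => ?_
    have h := ((w.map (leftIso S g).toHom)).edist_le
    rw [SimpleGraph.Walk.length_map] at h
    exact h
  refine le_antisymm (key g a b) ?_
  simpa using key g⁻¹ (g * a) (g * b)

theorem wordDist_mul_left (S : Set Γ) (g a b : Γ) :
    wordDist S (g * a) (g * b) = wordDist S a b := by
  simp only [wordDist, SimpleGraph.dist, edist_mul_left]

/-- The left translate of a geodesic ray. -/
def GeodesicRay.translate {S : Set Γ} (g : Γ) (r : GeodesicRay S) : GeodesicRay S :=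
  ⟨fun n => g * r.1 n, fun n k => by rw [wordDist_mul_left]; exact r.2 n k⟩

/-- The action of `Γ` on its Gromov boundary induced by left translation of rays. -/
def boundaryAct {S : Set Γ} (g : Γ) : Boundary S → Boundary S :=
  Quotient.map (GeodesicRay.translate g) (by
    rintro r₁ r₂ ⟨C, hC⟩
    exact ⟨C, fun n => by
      simp only [GeodesicRay.translate, edist_mul_left]
      exact hC n⟩)

end WordMetric

/-! ### Linear algebra -/

section Linear

/-- The quotient topology on projective space. -/
instance (K V : Type*) [DivisionRing K] [AddCommGroup V] [Module K V] [TopologicalSpace V] :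
    TopologicalSpace (ℙ K V) :=
  inferInstanceAs (TopologicalSpace (Quotient (projectivizationSetoid K V)))

/-- `𝕂²ᵐ` with its standard Hermitian inner product; `Sum.inl i` is the coordinate `i` and
`Sum.inr i` the coordinate `m + i`. -/
abbrev Vec (𝕂 : Type*) (m : ℕ) : Type _ := EuclideanSpace 𝕂 (Fin m ⊕ Fin m)

variable {𝕂 : Type*} [RCLike 𝕂] {m : ℕ}

/-- The standard symplectic (bilinear) form
`ω(u,v) = ∑ uᵢ vᵢ₊ₘ - ∑ uᵢ₊ₘ vᵢ` on `𝕂²ᵐ`, whose automorphism group is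
`Matrix.symplecticGroup (Fin m) 𝕂`. -/
def omega (u v : Vec 𝕂 m) : 𝕂 :=
  ∑ i : Fin m, u (Sum.inl i) * v (Sum.inr i) - ∑ i : Fin m, u (Sum.inr i) * v (Sum.inl i)

/-- The linear map of `𝕂²ᵐ` defined by a symplectic matrix. -/
def linMap (g : Matrix.symplecticGroup (Fin m) 𝕂) : Vec 𝕂 m →ₗ[𝕂] Vec 𝕂 m :=
  Matrix.toEuclideanLin (g : Matrix (Fin m ⊕ Fin m) (Fin m ⊕ Fin m) 𝕂)

/-- The `i`-th singular value `σᵢ(g)`, in decreasing order, for `i = 1, …, 2m`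
(Mathlib numbers them from `0`). -/
def sigma (i : ℕ) (g : Matrix.symplecticGroup (Fin m) 𝕂) : ℝ :=
  (linMap g).singularValues (i - 1)

/-- `ℓ` is the line through a largest semi-axis of the ellipsoid `g (unit sphere)`, that is,
spanned by `g v` for a unit vector `v` with `‖g v‖ = σ₁(g)`. This line is unique when
`σ₁(g) > σ₂(g)`. -/
def IsTopLine (g : Matrix.symplecticGroup (Fin m) 𝕂) (ℓ : ℙ 𝕂 (Vec 𝕂 m)) : Prop :=
  ∃ v : Vec 𝕂 m, ‖v‖ = 1 ∧ ‖linMap g v‖ = sigma 1 g ∧ ℓ.submodule = 𝕂 ∙ linMap g v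

end Linear

/-! ### Anosov representations -/

section Anosov

variable {Γ : Type*} [Group Γ] {𝕂 : Type*} [RCLike 𝕂] {m : ℕ}

/-- `ρ` is `1`-Anosov: `σ₁(ρ(γ)) / σ₂(ρ(γ)) ≥ c e^{μ|γ|}` for some `c, μ > 0`. -/
def IsOneAnosov (S : Set Γ) (ρ : Γ →* Matrix.symplecticGroup (Fin m) 𝕂) : Prop :=
  ∃ c μ : ℝ, 0 < c ∧ 0 < μ ∧ ∀ γ : Γ,
    c * Real.exp (μ * wordLength S γ) ≤ sigma 1 (ρ γ) / sigma 2 (ρ γ)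

/-- `ξ` is the Anosov limit map `ξ¹ : ∂Γ → ℙ(𝕂²ᵐ)` of the `1`-Anosov representation `ρ`: the
continuous `ρ`-equivariant map with the property (which determines it) that `ξ(x)` is the limit of
the most expanded directions of `ρ(γₙ)` along geodesic rays `(γₙ)` ending at `x`. -/
structure IsLimitMap (S : Set Γ) (ρ : Γ →* Matrix.symplecticGroup (Fin m) 𝕂)
    (ξ : Boundary S → ℙ 𝕂 (Vec 𝕂 m)) : Prop where
  continuous : Continuous ξ
  equivariant : ∀ (γ : Γ) (x : Boundary S),
    (ξ (boundaryAct γ x)).submodule = (ξ x).submodule.map (linMap (ρ γ))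
  tendsto : ∀ (r : GeodesicRay S) (ℓ : ℕ → ℙ 𝕂 (Vec 𝕂 m)),
    (∀ n, IsTopLine (ρ (r.1 n)) (ℓ n)) → Tendsto ℓ atTop (𝓝 (ξ (endpoint r)))

end Anosov

end AnosovSymplectic

end

/-! Everything rests on transversality of the limit map, `IsLimitMap.omega_ne_zero`: lines over
distinct boundary points are not `omega`-orthogonal. Given this, fix `e` spanning the line over
`w₀`. Every other line pairs nontrivially with `e`, so it has a unique unit representative `v` with
`omega v e > 0`, and it depends continuously on the line. The final nonvanishing is transversality
again.

For transversality, join rays to `x` and `y` into a bi-infinite quasi-geodesic and let `p i` be its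
image under `ρ`. Seen from any `p i`, the top lines of the forward and backward segments of length
`n` converge exponentially, uniformly in `i`, to translates of the two limit lines. If those lines
were `omega`-orthogonal, invariance of `omega` would make the two top vectors exponentially close to
orthogonal at every `i`. Since `g⁻¹` is the `omega`-adjoint of `g`, the norm of a product is
governed by this pairing (`IsTopVector.sigma_one_mul_le`), so each doubling of a segment gains an
exponentially small factor. Iterated doubling pushes the norm below 1, which is impossible in the
symplectic group (`not_forall_norm_omega_top_le`). -/

noncomputable section

namespace AnosovSymplectic

/-! ### Singular values as expansion rates -/

section SingularValues

open Module

variable {𝕂 E F : Type*} [RCLike 𝕂] [NormedAddCommGroup E] [InnerProductSpace 𝕂 E]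
  [FiniteDimensional 𝕂 E] [NormedAddCommGroup F] [InnerProductSpace 𝕂 F] [FiniteDimensional 𝕂 F]

/-- Expand in an orthonormal eigenbasis of `T* T`, whose eigenvalues are the squared singular
values. -/
theorem sq_norm_apply_eq_sum_singularValues (T : E →ₗ[𝕂] F) (v : E) :
    ‖T v‖ ^ 2 = ∑ i : Fin (finrank 𝕂 E), T.singularValues i ^ 2 *
      ‖inner 𝕂 (T.isSymmetric_adjoint_comp_self.eigenvectorBasis rfl i) v‖ ^ 2 := by
  set hT := T.isSymmetric_adjoint_comp_self
  set b := hT.eigenvectorBasis rfl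
  have h1 : (inner 𝕂 (T v) (T v) : 𝕂) = ∑ i, inner 𝕂 ((T.adjoint ∘ₗ T) v) (b i) * inner 𝕂 (b i) v := by
    rw [b.sum_inner_mul_inner, LinearMap.comp_apply, LinearMap.adjoint_inner_left]
  have h2 : ∀ i, (inner 𝕂 ((T.adjoint ∘ₗ T) v) (b i) : 𝕂) * inner 𝕂 (b i) v =
      ((T.singularValues i ^ 2 * ‖(inner 𝕂 (b i) v : 𝕂)‖ ^ 2 : ℝ) : 𝕂) := by
    intro i
    rw [hT v (b i), hT.apply_eigenvectorBasis, inner_smul_right, T.sq_singularValues_fin rfl,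
      ← inner_conj_symm v, mul_assoc, RCLike.conj_mul]
    push_cast
    rfl
  have h3 : ((‖T v‖ ^ 2 : ℝ) : 𝕂) = ((∑ i : Fin (finrank 𝕂 E), T.singularValues i ^ 2 *
      ‖(inner 𝕂 (b i) v : 𝕂)‖ ^ 2 : ℝ) : 𝕂) := by
    rw [RCLike.ofReal_sum, ← Finset.sum_congr rfl fun i _ => h2 i, ← h1, inner_self_eq_norm_sq_to_K]
    push_cast
    rfl
  exact_mod_cast h3

theorem norm_apply_le_singularValues_zero (T : E →ₗ[𝕂] F) (v : E) :
    ‖T v‖ ≤ T.singularValues 0 * ‖v‖ := by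
  refine le_of_sq_le_sq ?_ (mul_nonneg (T.singularValues_nonneg 0) (norm_nonneg v))
  rw [sq_norm_apply_eq_sum_singularValues, mul_pow,
    ← (T.isSymmetric_adjoint_comp_self.eigenvectorBasis rfl).sum_sq_norm_inner_right v,
    Finset.mul_sum]
  refine Finset.sum_le_sum fun i _ => mul_le_mul_of_nonneg_right ?_ (sq_nonneg _)
  exact pow_le_pow_left₀ (T.singularValues_nonneg _) (T.singularValues_antitone (Nat.zero_le _)) 2

/-- The first term of the singular value decomposition, with the remainder bounded by the second
singular value. -/
theorem exists_top_singular_vector (T : E →ₗ[𝕂] F) (hE : 0 < finrank 𝕂 E) :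
    ∃ b : E, ‖b‖ = 1 ∧ ‖T b‖ = T.singularValues 0 ∧
      ∀ v, ‖T (v - (inner 𝕂 b v : 𝕂) • b)‖ ≤ T.singularValues 1 * ‖v‖ := by
  set b := T.isSymmetric_adjoint_comp_self.eigenvectorBasis rfl with hb
  set o : Fin (finrank 𝕂 E) := ⟨0, hE⟩ with ho
  have hin : ∀ i, (inner 𝕂 (b i) (b o) : 𝕂) = if i = o then 1 else 0 := fun i =>
    orthonormal_iff_ite.1 b.orthonormal i o
  refine ⟨b o, b.orthonormal.1 o, ?_, fun v => ?_⟩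
  · refine (sq_eq_sq₀ (norm_nonneg _) (T.singularValues_nonneg 0)).1 ?_
    rw [sq_norm_apply_eq_sum_singularValues, Finset.sum_eq_single o]
    · rw [← hb, hin o]; simp [ho]
    · intro i _ hi
      rw [← hb, hin i]; simp [hi]
    · simp
  · refine le_of_sq_le_sq ?_ (mul_nonneg (T.singularValues_nonneg 1) (norm_nonneg v))
    rw [sq_norm_apply_eq_sum_singularValues, mul_pow, ← b.sum_sq_norm_inner_right v,
      Finset.mul_sum]
    refine Finset.sum_le_sum fun i _ => ?_
    rw [← hb, inner_sub_right, inner_smul_right, hin i]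
    by_cases hi : i = o
    · subst hi
      simp only [if_true, mul_one, sub_self, norm_zero]
      nlinarith [mul_nonneg (sq_nonneg (T.singularValues 1)) (sq_nonneg ‖(inner 𝕂 (b o) v : 𝕂)‖)]
    · simp only [hi, if_false, mul_zero, sub_zero]
      refine mul_le_mul_of_nonneg_right ?_ (sq_nonneg _)
      refine pow_le_pow_left₀ (T.singularValues_nonneg _) (T.singularValues_antitone ?_) 2
      by_contra h
      exact hi (Fin.ext (by simp only [ho]; omega))

end SingularValues

/-! ### The symplectic form, norms and top singular directions -/

section Symplectic

variable {𝕂 : Type*} [RCLike 𝕂] {m : ℕ}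

theorem omega_add_left (u u' v : Vec 𝕂 m) : omega (u + u') v = omega u v + omega u' v := by
  simp only [omega, PiLp.add_apply, add_mul, Finset.sum_add_distrib]; ring

theorem omega_smul_left (c : 𝕂) (u v : Vec 𝕂 m) : omega (c • u) v = c * omega u v := by
  simp only [omega, PiLp.smul_apply, smul_eq_mul, mul_assoc, ← Finset.mul_sum, mul_sub]

theorem omega_swap (u v : Vec 𝕂 m) : omega u v = -omega v u := by
  simp only [omega, neg_sub, mul_comm]

theorem omega_add_right (u v v' : Vec 𝕂 m) : omega u (v + v') = omega u v + omega u v' := by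
  rw [omega_swap, omega_add_left, omega_swap v, omega_swap v']; ring

theorem omega_smul_right (c : 𝕂) (u v : Vec 𝕂 m) : omega u (c • v) = c * omega u v := by
  rw [omega_swap, omega_smul_left, omega_swap v]; ring

/-- The conjugate-linear isometry representing the symplectic form by the Hermitian one. -/
def conjJ (v : Vec 𝕂 m) : Vec 𝕂 m :=
  WithLp.toLp 2 (Sum.elim (fun i => star (v (Sum.inr i))) (fun i => -star (v (Sum.inl i))))

theorem omega_eq_inner (u v : Vec 𝕂 m) : omega u v = inner 𝕂 (conjJ v) u := by
  simp [omega, conjJ, PiLp.inner_apply, Fintype.sum_sum_type, sub_eq_add_neg]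

theorem norm_conjJ (v : Vec 𝕂 m) : ‖conjJ v‖ = ‖v‖ := by
  simp [EuclideanSpace.norm_eq, conjJ, Fintype.sum_sum_type, add_comm]

theorem conjJ_conjJ (v : Vec 𝕂 m) : conjJ (conjJ v) = -v := by
  ext i
  rcases i with i | i <;> simp [conjJ]

theorem norm_omega_le (u v : Vec 𝕂 m) : ‖omega u v‖ ≤ ‖u‖ * ‖v‖ := by
  rw [omega_eq_inner, mul_comm, ← norm_conjJ v]
  exact norm_inner_le_norm _ _

theorem norm_omega_conjJ (v : Vec 𝕂 m) : ‖omega v (conjJ v)‖ = ‖v‖ ^ 2 := by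
  rw [omega_eq_inner, conjJ_conjJ, inner_neg_left, norm_neg, inner_self_eq_norm_sq_to_K]
  simp

theorem continuous_omega_left (v : Vec 𝕂 m) : Continuous fun u : Vec 𝕂 m => omega u v := by
  simp only [omega_eq_inner]
  fun_prop

theorem linMap_mul (g h : Matrix.symplecticGroup (Fin m) 𝕂) (v : Vec 𝕂 m) :
    linMap (g * h) v = linMap g (linMap h v) := by
  simp [linMap, Matrix.toLpLin_apply]

theorem linMap_one (v : Vec 𝕂 m) : linMap (1 : Matrix.symplecticGroup (Fin m) 𝕂) v = v := by
  simp [linMap]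

theorem omega_eq_dotProduct (u v : Vec 𝕂 m) :
    omega u v = -(u.ofLp ⬝ᵥ (Matrix.J (Fin m) 𝕂).mulVec v.ofLp) := by
  simp [omega, Matrix.J, dotProduct, Matrix.mulVec, Fintype.sum_sum_type, Matrix.one_apply, Matrix.neg_apply]
  ring

theorem omega_linMap (g : Matrix.symplecticGroup (Fin m) 𝕂) (u v : Vec 𝕂 m) :
    omega (linMap g u) (linMap g v) = omega u v := by
  have h := SymplecticGroup.mem_iff'.1 g.2
  simp only [omega_eq_dotProduct, linMap, Matrix.toLpLin_apply]
  rw [← Matrix.vecMul_transpose, Matrix.dotProduct_mulVec, Matrix.dotProduct_mulVec,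
    Matrix.dotProduct_mulVec, Matrix.vecMul_vecMul, Matrix.vecMul_vecMul, ← mul_assoc, h]

theorem omega_linMap_left (g : Matrix.symplecticGroup (Fin m) 𝕂) (u v : Vec 𝕂 m) :
    omega (linMap g u) v = omega u (linMap g⁻¹ v) := by
  rw [← omega_linMap g u, ← linMap_mul, mul_inv_cancel, linMap_one]

theorem sigma_nonneg (i : ℕ) (g : Matrix.symplecticGroup (Fin m) 𝕂) : 0 ≤ sigma i g :=
  LinearMap.singularValues_nonneg _ _

theorem norm_linMap_le (g : Matrix.symplecticGroup (Fin m) 𝕂) (v : Vec 𝕂 m) :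
    ‖linMap g v‖ ≤ sigma 1 g * ‖v‖ :=
  norm_apply_le_singularValues_zero _ v

theorem exists_norm_linMap_eq (hm : 1 ≤ m) (g : Matrix.symplecticGroup (Fin m) 𝕂) :
    ∃ v : Vec 𝕂 m, ‖v‖ = 1 ∧ ‖linMap g v‖ = sigma 1 g ∧
      ∀ w, ‖linMap g (w - (inner 𝕂 v w : 𝕂) • v)‖ ≤ sigma 2 g * ‖w‖ :=
  exists_top_singular_vector (linMap g) (by simp; omega)

/-- Duality: testing against `z = conjJ (g v)` gives equality in Cauchy–Schwarz, and `g` moves to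
the other side of `omega` as `g⁻¹`. -/
theorem norm_linMap_le_of_omega_inv_le (g : Matrix.symplecticGroup (Fin m) 𝕂) (v : Vec 𝕂 m)
    {C : ℝ} (hC₀ : 0 ≤ C) (hC : ∀ z : Vec 𝕂 m, ‖omega v (linMap g⁻¹ z)‖ ≤ C * ‖z‖) :
    ‖linMap g v‖ ≤ C := by
  rcases (norm_nonneg (linMap g v)).eq_or_lt with h0 | h0
  · rwa [← h0]
  · have h := hC (conjJ (linMap g v))
    rw [← omega_linMap_left, norm_omega_conjJ, norm_conjJ, sq] at h
    exact le_of_mul_le_mul_right h h0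

theorem sigma_one_le_sigma_one_inv (hm : 1 ≤ m) (g : Matrix.symplecticGroup (Fin m) 𝕂) :
    sigma 1 g ≤ sigma 1 g⁻¹ := by
  obtain ⟨v, hv, hgv, -⟩ := exists_norm_linMap_eq hm g
  rw [← hgv]
  refine norm_linMap_le_of_omega_inv_le g v (sigma_nonneg _ _) fun z => ?_
  calc ‖omega v (linMap g⁻¹ z)‖ ≤ ‖v‖ * ‖linMap g⁻¹ z‖ := norm_omega_le _ _
    _ ≤ sigma 1 g⁻¹ * ‖z‖ := by rw [hv, one_mul]; exact norm_linMap_le _ _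

theorem sigma_one_inv (hm : 1 ≤ m) (g : Matrix.symplecticGroup (Fin m) 𝕂) :
    sigma 1 g⁻¹ = sigma 1 g :=
  le_antisymm (by simpa using sigma_one_le_sigma_one_inv hm g⁻¹) (sigma_one_le_sigma_one_inv hm g)

theorem sigma_one_mul_le (hm : 1 ≤ m) (g h : Matrix.symplecticGroup (Fin m) 𝕂) :
    sigma 1 (g * h) ≤ sigma 1 g * sigma 1 h := by
  obtain ⟨v, hv, hgv, -⟩ := exists_norm_linMap_eq hm (g * h)
  rw [← hgv, linMap_mul]
  refine (norm_linMap_le g _).trans (mul_le_mul_of_nonneg_left ?_ (sigma_nonneg _ _))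
  simpa [hv] using norm_linMap_le h v

/-- `g` and `g⁻¹` have the same operator norm, and the product of these norms is at least 1. -/
theorem one_le_sigma_one (hm : 1 ≤ m) (g : Matrix.symplecticGroup (Fin m) 𝕂) : 1 ≤ sigma 1 g := by
  obtain ⟨v, hv, -⟩ := exists_norm_linMap_eq hm g
  have h1 : (1 : ℝ) ≤ sigma 1 g⁻¹ * sigma 1 g := by
    calc (1 : ℝ) = ‖linMap g⁻¹ (linMap g v)‖ := by rw [← linMap_mul, inv_mul_cancel, linMap_one, hv]
      _ ≤ sigma 1 g⁻¹ * ‖linMap g v‖ := norm_linMap_le _ _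
      _ ≤ sigma 1 g⁻¹ * sigma 1 g := by
        refine mul_le_mul_of_nonneg_left ?_ (sigma_nonneg _ _)
        simpa [hv] using norm_linMap_le g v
  rw [sigma_one_inv hm] at h1
  nlinarith [sigma_nonneg 1 g]

/-- `u` is a unit vector spanning the line of a largest semi-axis of the image of the unit ball,
such that the image lies within `sigma 2 g` of that line. -/
def IsTopVector (g : Matrix.symplecticGroup (Fin m) 𝕂) (u : Vec 𝕂 m) : Prop :=
  ‖u‖ = 1 ∧ (∃ s : Vec 𝕂 m, ‖s‖ = 1 ∧ linMap g s = (sigma 1 g : 𝕂) • u) ∧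
    ∀ v, ∃ (α : 𝕂) (w : Vec 𝕂 m), linMap g v = α • u + w ∧ ‖α‖ ≤ sigma 1 g * ‖v‖ ∧
      ‖w‖ ≤ sigma 2 g * ‖v‖

theorem exists_isTopVector (hm : 1 ≤ m) (g : Matrix.symplecticGroup (Fin m) 𝕂) :
    ∃ u, IsTopVector g u := by
  obtain ⟨s, hs, hgs, hw⟩ := exists_norm_linMap_eq hm g
  have hpos : 0 < sigma 1 g := one_pos.trans_le (one_le_sigma_one hm g)
  have hne : (sigma 1 g : 𝕂) ≠ 0 := RCLike.ofReal_ne_zero.2 hpos.ne'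
  have hgs' : linMap g s = (sigma 1 g : 𝕂) • ((sigma 1 g : 𝕂)⁻¹ • linMap g s) := by
    rw [smul_inv_smul₀ hne]
  refine ⟨(sigma 1 g : 𝕂)⁻¹ • linMap g s, ?_, ⟨s, hs, hgs'⟩, fun v =>
    ⟨(inner 𝕂 s v : 𝕂) * sigma 1 g, linMap g (v - (inner 𝕂 s v : 𝕂) • s), ?_, ?_, hw v⟩⟩
  · rw [norm_smul, norm_inv, RCLike.norm_ofReal, abs_of_pos hpos, hgs, inv_mul_cancel₀ hpos.ne']
  · rw [mul_smul, ← hgs', ← map_smul, ← map_add, add_sub_cancel]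
  · rw [norm_mul, RCLike.norm_ofReal, abs_of_pos hpos, mul_comm]
    refine mul_le_mul_of_nonneg_left ?_ hpos.le
    simpa [hs] using norm_inner_le_norm (𝕜 := 𝕂) s v

theorem IsTopVector.ne_zero {g : Matrix.symplecticGroup (Fin m) 𝕂} {u : Vec 𝕂 m}
    (h : IsTopVector g u) : u ≠ 0 := by
  rintro rfl
  simpa using h.1

theorem IsTopVector.isTopLine (hm : 1 ≤ m) {g : Matrix.symplecticGroup (Fin m) 𝕂} {u : Vec 𝕂 m}
    (h : IsTopVector g u) : IsTopLine g (Projectivization.mk 𝕂 u h.ne_zero) := by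
  have hpos : 0 < sigma 1 g := one_pos.trans_le (one_le_sigma_one hm g)
  have hne : (sigma 1 g : 𝕂) ≠ 0 := RCLike.ofReal_ne_zero.2 hpos.ne'
  obtain ⟨hu, ⟨s, hs, hgs⟩, -⟩ := h
  refine ⟨s, hs, ?_, ?_⟩
  · rw [hgs, norm_smul, hu, RCLike.norm_ofReal, abs_of_pos hpos, mul_one]
  · rw [Projectivization.submodule_mk, hgs, Submodule.span_singleton_smul_eq hne.isUnit]

/-- Right multiplication by a bounded element moves the top line little. -/
theorem IsTopVector.abs_norm_omega_sub_le (hm : 1 ≤ m)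
    {g h : Matrix.symplecticGroup (Fin m) 𝕂} {u u' z : Vec 𝕂 m} {M κ : ℝ}
    (hu : IsTopVector g u) (hu' : IsTopVector (g * h) u') (hM : sigma 1 h ≤ M)
    (hκ : sigma 2 g ≤ κ * sigma 1 g) (hz : ‖z‖ = 1) :
    |‖omega u' z‖ - ‖omega u z‖| ≤ 2 * M ^ 2 * κ := by
  obtain ⟨hu1, -, hdec⟩ := hu
  obtain ⟨hu1', ⟨s, hs, hgs⟩, -⟩ := hu'
  have hg := one_le_sigma_one hm g
  have hgh := one_le_sigma_one hm (g * h)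
  have hh := one_le_sigma_one hm h
  have hpos : 0 < sigma 1 (g * h) := one_pos.trans_le hgh
  have hne : (sigma 1 (g * h) : 𝕂) ≠ 0 := RCLike.ofReal_ne_zero.2 hpos.ne'
  have hκ0 : 0 ≤ κ := by
    by_contra hneg
    nlinarith [sigma_nonneg 2 g]
  obtain ⟨α, w, hαw, -, hw⟩ := hdec (linMap h s)
  have hw1 : ‖w‖ ≤ M ^ 2 * κ * sigma 1 (g * h) := by
    -- Write `g = (g h) h⁻¹`; `h⁻¹` has the same norm as `h`.
    have h1 : sigma 1 g ≤ sigma 1 (g * h) * M := by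
      have := sigma_one_mul_le hm (g * h) h⁻¹
      rw [mul_inv_cancel_right, sigma_one_inv hm] at this
      exact this.trans (mul_le_mul_of_nonneg_left hM hpos.le)
    have h2 : ‖linMap h s‖ ≤ M := by
      have := norm_linMap_le h s
      rw [hs, mul_one] at this
      exact this.trans hM
    calc ‖w‖ ≤ sigma 2 g * ‖linMap h s‖ := hw
      _ ≤ (κ * sigma 1 g) * M := mul_le_mul hκ h2 (norm_nonneg _) (by positivity)
      _ ≤ (κ * (sigma 1 (g * h) * M)) * M := by gcongr; linarith
      _ = M ^ 2 * κ * sigma 1 (g * h) := by ring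
  have hu'' : u' = (α / sigma 1 (g * h)) • u + (sigma 1 (g * h) : 𝕂)⁻¹ • w := by
    rw [← inv_smul_smul₀ hne u', ← hgs, linMap_mul, hαw, smul_add, smul_smul, div_eq_inv_mul]
  set β : 𝕂 := α / sigma 1 (g * h)
  set w' : Vec 𝕂 m := (sigma 1 (g * h) : 𝕂)⁻¹ • w
  have hw' : ‖w'‖ ≤ M ^ 2 * κ := by
    rw [norm_smul, norm_inv, RCLike.norm_ofReal, abs_of_pos hpos, inv_mul_le_iff₀ hpos]
    linarith
  have hβ : ‖β • u‖ = ‖β‖ := by rw [norm_smul, hu1, mul_one]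
  -- Both `u` and `u'` are unit vectors, so a small remainder `w'` forces `‖β‖` close to 1.
  have hβ1 : |1 - ‖β‖| ≤ M ^ 2 * κ := by
    have := abs_norm_sub_norm_le u' (β • u)
    rw [hu1', hβ, hu'', add_sub_cancel_left] at this
    exact this.trans hw'
  have h3 : |‖omega u' z‖ - ‖β‖ * ‖omega u z‖| ≤ M ^ 2 * κ := by
    have := abs_norm_sub_norm_le (omega u' z) (omega (β • u) z)
    rw [hu'', omega_add_left, add_sub_cancel_left, omega_smul_left, norm_mul] at this
    rw [hu'', omega_add_left, omega_smul_left]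
    refine this.trans ((norm_omega_le w' z).trans ?_)
    rwa [hz, mul_one]
  have h4 : |‖β‖ * ‖omega u z‖ - ‖omega u z‖| ≤ M ^ 2 * κ := by
    have h5 : ‖omega u z‖ ≤ 1 := by simpa [hu1, hz] using norm_omega_le u z
    rw [show ‖β‖ * ‖omega u z‖ - ‖omega u z‖ = -((1 - ‖β‖) * ‖omega u z‖) by ring, abs_neg, abs_mul,
      abs_norm]
    calc |1 - ‖β‖| * ‖omega u z‖ ≤ |1 - ‖β‖| * 1 := by gcongr
      _ ≤ M ^ 2 * κ := by rwa [mul_one]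
  calc |‖omega u' z‖ - ‖omega u z‖|
      ≤ |‖omega u' z‖ - ‖β‖ * ‖omega u z‖| + |‖β‖ * ‖omega u z‖ - ‖omega u z‖| := abs_sub_le _ _ _
    _ ≤ 2 * M ^ 2 * κ := by linarith

/-- The norm of a product is small compared with the product of the norms when the relevant top
lines are nearly `omega`-orthogonal. -/
theorem IsTopVector.sigma_one_mul_le (hm : 1 ≤ m) {g h : Matrix.symplecticGroup (Fin m) 𝕂}
    {u u' : Vec 𝕂 m} {κ κ' : ℝ} (hu : IsTopVector h u) (hu' : IsTopVector g⁻¹ u')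
    (hκ : sigma 2 h ≤ κ * sigma 1 h) (hκ' : sigma 2 g⁻¹ ≤ κ' * sigma 1 g⁻¹) :
    sigma 1 (g * h) ≤ sigma 1 g * sigma 1 h * (‖omega u u'‖ + κ + κ') := by
  rw [sigma_one_inv hm] at hκ'
  obtain ⟨s, hs, hgs, -⟩ := exists_norm_linMap_eq hm (g * h)
  obtain ⟨α, w, hαw, hα, hw⟩ := hu.2.2 s
  have hg := one_le_sigma_one hm g
  have hh := one_le_sigma_one hm h
  have hκ0 : 0 ≤ κ := by
    by_contra hneg
    nlinarith [sigma_nonneg 2 h]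
  have hκ0' : 0 ≤ κ' := by
    by_contra hneg
    nlinarith [sigma_nonneg 2 g⁻¹]
  rw [hs, mul_one] at hα hw
  have hv : ‖linMap h s‖ ≤ sigma 1 h := by simpa [hs] using norm_linMap_le h s
  have h1 : ‖omega (linMap h s) u'‖ ≤ sigma 1 h * (‖omega u u'‖ + κ) := by
    rw [hαw, omega_add_left, omega_smul_left]
    calc ‖α * omega u u' + omega w u'‖ ≤ ‖α‖ * ‖omega u u'‖ + ‖w‖ * ‖u'‖ :=
          (norm_add_le _ _).trans (add_le_add (norm_mul _ _).le (norm_omega_le _ _))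
      _ ≤ sigma 1 h * ‖omega u u'‖ + κ * sigma 1 h := by
          rw [hu'.1, mul_one]
          exact add_le_add (mul_le_mul_of_nonneg_right hα (norm_nonneg _)) (hw.trans hκ)
      _ = _ := by ring
  rw [← hgs, linMap_mul]
  -- By duality it is enough to pair `h s` with `g⁻¹ z`, which splits along `u'` just as `h s`
  -- splits along `u`.
  refine norm_linMap_le_of_omega_inv_le g _ (by positivity) fun z => ?_
  obtain ⟨β, w', hβw, hβ, hw'⟩ := hu'.2.2 z
  rw [sigma_one_inv hm] at hβ
  rw [hβw, omega_add_right, omega_smul_right]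
  calc ‖β * omega (linMap h s) u' + omega (linMap h s) w'‖
      ≤ ‖β‖ * ‖omega (linMap h s) u'‖ + ‖linMap h s‖ * ‖w'‖ :=
        (norm_add_le _ _).trans (add_le_add (norm_mul _ _).le (norm_omega_le _ _))
    _ ≤ (sigma 1 g * ‖z‖) * (sigma 1 h * (‖omega u u'‖ + κ)) +
        sigma 1 h * ((κ' * sigma 1 g) * ‖z‖) := by
        refine add_le_add (mul_le_mul hβ h1 (norm_nonneg _) (by positivity))
          (mul_le_mul hv (hw'.trans ?_) (norm_nonneg _) (by positivity))
        exact mul_le_mul_of_nonneg_right hκ' (norm_nonneg _)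
    _ = _ := by ring

end Symplectic

/-! ### Diverging rays in hyperbolic groups -/

section Geometry

variable {Γ : Type*} [Group Γ] {S : Set Γ}

theorem IsWordHyperbolic.connected (hS : IsWordHyperbolic S) :
    (SimpleGraph.mulCayley S).Connected := by
  have key : ∀ g : Γ, (SimpleGraph.mulCayley S).edist 1 g ≠ ⊤ := by
    intro g
    have hg : g ∈ Subgroup.closure S := by rw [hS.closure_eq_top]; trivial
    induction hg using Subgroup.closure_induction with
    | mem x hx =>
      by_cases h : x = 1
      · simp [h]
      · rw [SimpleGraph.edist_ne_top_iff_reachable]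
        refine SimpleGraph.Adj.reachable ?_
        rw [SimpleGraph.mulCayley_adj]
        exact ⟨Ne.symm h, Or.inl (by simpa using hx)⟩
    | one => simp
    | mul x y _ _ hx hy =>
      rw [← edist_mul_left S x, mul_one] at hy
      rw [SimpleGraph.edist_ne_top_iff_reachable] at hx hy ⊢
      exact hx.trans hy
    | inv x _ hx =>
      rw [← edist_mul_left S x⁻¹, inv_mul_cancel, mul_one, SimpleGraph.edist_comm] at hx
      exact hx
  refine SimpleGraph.connected_iff_exists_forall_reachable _ |>.2 ⟨1, fun g => ?_⟩
  exact SimpleGraph.edist_ne_top_iff_reachable.1 (key g)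

theorem wordDist_comm (g h : Γ) : wordDist S g h = wordDist S h g := SimpleGraph.dist_comm

theorem wordLength_inv_mul (g h : Γ) : wordLength S (g⁻¹ * h) = wordDist S g h := by
  rw [wordLength, ← wordDist_mul_left S g, mul_one, mul_inv_cancel_left]

theorem IsWordHyperbolic.wordDist_triangle (hS : IsWordHyperbolic S) (a b c : Γ) :
    (wordDist S a c : ℝ) ≤ wordDist S a b + wordDist S b c := by
  exact_mod_cast hS.connected.dist_triangle

theorem GeodesicRay.wordDist_eq (r : GeodesicRay S) (i j : ℕ) :
    (wordDist S (r.1 i) (r.1 j) : ℝ) = |(i : ℝ) - j| := by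
  rcases le_total i j with h | h
  · obtain ⟨k, rfl⟩ := Nat.exists_eq_add_of_le h
    rw [r.2 i k]; simp
  · obtain ⟨k, rfl⟩ := Nat.exists_eq_add_of_le h
    rw [wordDist_comm, r.2 j k]; simp

theorem GeodesicRay.inv_mul_mem (r : GeodesicRay S) (n : ℕ) :
    (r.1 n)⁻¹ * r.1 (n + 1) ∈ S ∨ (r.1 (n + 1))⁻¹ * r.1 n ∈ S := by
  have h := r.2 n 1
  rw [wordDist, SimpleGraph.dist_eq_one_iff_adj, SimpleGraph.mulCayley_adj] at h
  exact h.2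

/-- Rays with distinct endpoints diverge at full speed. -/
theorem IsWordHyperbolic.exists_add_le_wordDist (hS : IsWordHyperbolic S) {r₁ r₂ : GeodesicRay S}
    (h : endpoint r₁ ≠ endpoint r₂) :
    ∃ C : ℝ, ∀ i j : ℕ, (i : ℝ) + j - C ≤ wordDist S (r₁.1 i) (r₂.1 j) := by
  obtain ⟨δ, hδ⟩ := hS.hyperbolic
  by_contra! hcon
  refine h (Quotient.sound ?_)
  set o := r₁.1 0 with ho
  set D : ℝ := ((wordDist S (r₁.1 0) (r₂.1 0) : ℕ) : ℝ) with hD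
  have hδ' := le_abs_self δ
  have hD0 : 0 ≤ D := Nat.cast_nonneg _
  have hd1 : ∀ n, (wordDist S o (r₁.1 n) : ℝ) = n := fun n => by
    rw [r₁.wordDist_eq]; simp
  have hd2 : ∀ n, (wordDist S o (r₂.1 n) : ℝ) ≤ n + D := fun n => by
    have h1 := hS.wordDist_triangle o (r₂.1 0) (r₂.1 n)
    rw [r₂.wordDist_eq] at h1
    simp at h1
    linarith
  have hd2' : ∀ n : ℕ, (n : ℝ) - D ≤ wordDist S o (r₂.1 n) := fun n => by
    have h1 := hS.wordDist_triangle (r₂.1 0) o (r₂.1 n)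
    rw [r₂.wordDist_eq, wordDist_comm (r₂.1 0)] at h1
    simp at h1
    linarith
  have key : ∀ n : ℕ, (wordDist S (r₁.1 n) (r₂.1 n) : ℝ) ≤ 3 * D + 4 * |δ| := by
    intro n
    -- The constant makes the Gromov product of `r₁ i` and `r₂ j` at least `n`, with `i, j ≥ n`. The
    -- four-point condition along `r₁ n`, `r₁ i`, `r₂ j`, `r₂ n` then bounds the distance at time
    -- `n`.
    obtain ⟨i, j, hij⟩ := hcon (2 * n + D)
    have ti := hS.wordDist_triangle o (r₁.1 i) (r₂.1 j)
    have tj := hS.wordDist_triangle o (r₂.1 j) (r₁.1 i)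
    rw [wordDist_comm (r₂.1 j)] at tj
    rw [hd1] at ti tj
    have hj1 := hd2' j
    have hj2 := hd2 j
    have hn1 := hd2' n
    have hn2 := hd2 n
    have hin : (n : ℝ) ≤ i := by linarith
    have hjn : (n : ℝ) ≤ j := by linarith
    have g1 : gromovProduct S o (r₁.1 n) (r₁.1 i) = n := by
      rw [gromovProduct, hd1, hd1, r₁.wordDist_eq, abs_sub_comm, abs_of_nonneg (by linarith)]; ring
    have g2 : (n : ℝ) ≤ gromovProduct S o (r₁.1 i) (r₂.1 j) := by
      rw [gromovProduct, hd1]; linarith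
    have g3 : (n : ℝ) - D ≤ gromovProduct S o (r₂.1 j) (r₂.1 n) := by
      rw [gromovProduct, r₂.wordDist_eq, abs_of_nonneg (by linarith)]; linarith
    have g4 : (n : ℝ) - |δ| ≤ gromovProduct S o (r₁.1 n) (r₂.1 j) := by
      have := hδ o (r₁.1 n) (r₁.1 i) (r₂.1 j)
      have h5 := le_min g1.ge g2
      linarith
    have g5 : (n : ℝ) - D - 2 * |δ| ≤ gromovProduct S o (r₁.1 n) (r₂.1 n) := by
      have := hδ o (r₁.1 n) (r₂.1 j) (r₂.1 n)
      have h5 : (n : ℝ) - D - |δ| ≤ _ := le_min (a := gromovProduct S o (r₁.1 n) (r₂.1 j))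
        (b := gromovProduct S o (r₂.1 j) (r₂.1 n)) (by linarith) (by linarith [abs_nonneg δ])
      linarith
    rw [gromovProduct, hd1] at g5
    linarith
  obtain ⟨N, hN⟩ := exists_nat_ge (3 * D + 4 * |δ|)
  refine ⟨N, fun n => ?_⟩
  rw [← (hS.connected _ _).coe_dist_eq_edist]
  exact_mod_cast (key n).trans hN

/-- The bi-infinite path following `r₂` backwards and then `r₁`. -/
def rayConcat (r₁ r₂ : GeodesicRay S) : ℤ → Γ
  | Int.ofNat n => r₁.1 n
  | Int.negSucc n => r₂.1 n

theorem rayConcat_natCast (r₁ r₂ : GeodesicRay S) (n : ℕ) : rayConcat r₁ r₂ n = r₁.1 n := rfl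

theorem rayConcat_negSucc (r₁ r₂ : GeodesicRay S) (n : ℕ) :
    rayConcat r₁ r₂ (Int.negSucc n) = r₂.1 n := rfl

/-- The concatenation is a quasi-geodesic: full-speed divergence handles points on different rays.
In the constant, 1 absorbs the index shift of the backward ray, and adding `D` makes it nonnegative
for points on one ray. -/
theorem IsWordHyperbolic.exists_sub_le_wordDist_rayConcat (hS : IsWordHyperbolic S)
    {r₁ r₂ : GeodesicRay S} (h : endpoint r₁ ≠ endpoint r₂) :
    ∃ C : ℝ, ∀ i j : ℤ, |(i : ℝ) - j| - C ≤ wordDist S (rayConcat r₁ r₂ i) (rayConcat r₁ r₂ j) := by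
  obtain ⟨C, hC⟩ := hS.exists_add_le_wordDist h
  have hC0 : 0 ≤ C + wordDist S (r₁.1 0) (r₂.1 0) := by
    have := hC 0 0
    simp at this
    linarith
  set D : ℝ := ((wordDist S (r₁.1 0) (r₂.1 0) : ℕ) : ℝ)
  have hD : 0 ≤ D := Nat.cast_nonneg _
  refine ⟨C + D + 1, fun i j => ?_⟩
  rcases i with i | i <;> rcases j with j | j
  · simp only [Int.ofNat_eq_natCast, rayConcat_natCast, r₁.wordDist_eq, Int.cast_natCast]
    linarith
  · have := hC i j
    simp only [Int.ofNat_eq_natCast, rayConcat_natCast, rayConcat_negSucc, Int.cast_natCast,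
      Int.cast_negSucc]
    rw [abs_of_nonneg (by push_cast; linarith [
      (Nat.cast_nonneg i : (0 : ℝ) ≤ i), (Nat.cast_nonneg j : (0 : ℝ) ≤ j)])]
    push_cast
    linarith
  · have := hC j i
    rw [wordDist_comm]
    simp only [Int.ofNat_eq_natCast, rayConcat_natCast, rayConcat_negSucc, Int.cast_natCast,
      Int.cast_negSucc]
    rw [abs_sub_comm, abs_of_nonneg (by push_cast; linarith [
      (Nat.cast_nonneg i : (0 : ℝ) ≤ i), (Nat.cast_nonneg j : (0 : ℝ) ≤ j)])]
    push_cast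
    linarith
  · simp only [rayConcat_negSucc, r₂.wordDist_eq, Int.cast_negSucc]
    rw [show (-((i + 1 : ℕ) : ℝ)) - (-((j + 1 : ℕ) : ℝ)) = -((i : ℝ) - j) by push_cast; ring, abs_neg]
    linarith

/-- Only the junction from index `-1` to `0` can leave the generators and their inverses. With `S`
finite, the steps therefore have uniformly bounded images under `ρ`. -/
theorem inv_mul_rayConcat_mem (r₁ r₂ : GeodesicRay S) (i : ℤ) :
    (rayConcat r₁ r₂ i)⁻¹ * rayConcat r₁ r₂ (i + 1) ∈ S ∨
    ((rayConcat r₁ r₂ i)⁻¹ * rayConcat r₁ r₂ (i + 1))⁻¹ ∈ S ∨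
    (rayConcat r₁ r₂ i)⁻¹ * rayConcat r₁ r₂ (i + 1) = (r₂.1 0)⁻¹ * r₁.1 0 := by
  rw [mul_inv_rev, inv_inv]
  rcases i with i | _ | i
  · rcases r₁.inv_mul_mem i with h | h
    · exact Or.inl h
    · exact Or.inr (Or.inl h)
  · exact Or.inr (Or.inr rfl)
  · rcases r₂.inv_mul_mem i with h | h
    · exact Or.inr (Or.inl h)
    · exact Or.inl h

end Geometry

/-! ### Projective space and the normalized representative -/

section Projective

variable {𝕂 : Type*} [RCLike 𝕂] {m : ℕ}

theorem isOpen_iff_isOpen_mk {s : Set (ℙ 𝕂 (Vec 𝕂 m))} :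
    IsOpen s ↔ IsOpen {v : {v : Vec 𝕂 m // v ≠ 0} | Projectivization.mk 𝕂 v.1 v.2 ∈ s} :=
  Iff.rfl

/-- The function `[v] ↦ |ω(v, z)| / ‖v‖` on projective space. -/
def normOmega (z : Vec 𝕂 m) : ℙ 𝕂 (Vec 𝕂 m) → ℝ :=
  Projectivization.lift (fun v => ‖omega v.1 z‖ / ‖v.1‖) (by
    rintro ⟨a, ha⟩ ⟨b, hb⟩ t rfl
    have ht : t ≠ 0 := by rintro rfl; simp at ha
    simp only [omega_smul_left, norm_mul, norm_smul]
    rw [mul_div_mul_left _ _ (norm_ne_zero_iff.2 ht)])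

theorem normOmega_mk (z v : Vec 𝕂 m) (hv : v ≠ 0) :
    normOmega z (Projectivization.mk 𝕂 v hv) = ‖omega v z‖ / ‖v‖ := rfl

theorem continuous_normOmega (z : Vec 𝕂 m) : Continuous (normOmega (𝕂 := 𝕂) z) := by
  refine continuous_def.2 fun s hs => isOpen_iff_isOpen_mk.2 ?_
  have h : Continuous fun v : {v : Vec 𝕂 m // v ≠ 0} => ‖omega v.1 z‖ / ‖v.1‖ :=
    (((continuous_omega_left z).comp continuous_subtype_val).norm).div
      continuous_subtype_val.norm fun v => norm_ne_zero_iff.2 v.2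
  exact h.isOpen_preimage s hs

theorem normOmega_eq_of_submodule_eq {ℓ : ℙ 𝕂 (Vec 𝕂 m)} {e : Vec 𝕂 m} (he : ‖e‖ = 1)
    (h : ℓ.submodule = 𝕂 ∙ e) (z : Vec 𝕂 m) : normOmega z ℓ = ‖omega e z‖ := by
  have he0 : e ≠ 0 := by rintro rfl; simp at he
  have : ℓ = Projectivization.mk 𝕂 e he0 :=
    Projectivization.submodule_injective (by rw [h, Projectivization.submodule_mk])
  rw [this, normOmega_mk, he, div_one]

theorem exists_unit_submodule_eq (ℓ : ℙ 𝕂 (Vec 𝕂 m)) :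
    ∃ e : Vec 𝕂 m, ‖e‖ = 1 ∧ ℓ.submodule = 𝕂 ∙ e := by
  have h0 := ℓ.rep_nonzero
  have hn : ((‖ℓ.rep‖ : 𝕂)⁻¹) ≠ 0 := inv_ne_zero (RCLike.ofReal_ne_zero.2 (norm_ne_zero_iff.2 h0))
  refine ⟨(‖ℓ.rep‖ : 𝕂)⁻¹ • ℓ.rep, norm_smul_inv_norm h0, ?_⟩
  rw [Submodule.span_singleton_smul_eq hn.isUnit, ℓ.submodule_eq]

/-- The representative `v` of a line normalized by `‖v‖ = 1` and `ω(v, e) > 0`. -/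
def normalizedRep (e : Vec 𝕂 m) : ℙ 𝕂 (Vec 𝕂 m) → Vec 𝕂 m :=
  Projectivization.lift
    (fun v => (star (omega v.1 e) * ((‖omega v.1 e‖ * ‖v.1‖ : ℝ) : 𝕂)⁻¹) • v.1) (by
    -- No condition on `omega b e` is needed: where it vanishes, both sides are zero. Otherwise
    -- `star t * t` cancels the two factors `‖t‖`.
    rintro ⟨a, ha⟩ ⟨b, hb⟩ t rfl
    have ht : t ≠ 0 := by rintro rfl; simp at ha
    have ht' : (‖t‖ : 𝕂) ≠ 0 := RCLike.ofReal_ne_zero.2 (norm_ne_zero_iff.2 ht)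
    have h1 : star t * t = (‖t‖ : 𝕂) * ‖t‖ := by
      rw [← starRingEnd_apply, RCLike.conj_mul, sq]
    simp only [omega_smul_left, norm_mul, norm_smul, smul_smul, star_mul']
    congr 1
    push_cast
    simp only [mul_inv]
    calc _ = (star t * t) * ((‖t‖ : 𝕂)⁻¹ * (‖t‖ : 𝕂)⁻¹) *
        (star (omega b e) * ((‖omega b e‖ : 𝕂)⁻¹ * (‖b‖ : 𝕂)⁻¹)) := by ring
      _ = _ := by
        rw [h1, show ((‖t‖ : 𝕂) * ‖t‖) * ((‖t‖ : 𝕂)⁻¹ * (‖t‖ : 𝕂)⁻¹) = 1 by field_simp, one_mul])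

theorem normalizedRep_mk (e v : Vec 𝕂 m) (hv : v ≠ 0) :
    normalizedRep e (Projectivization.mk 𝕂 v hv) =
      (star (omega v e) * ((‖omega v e‖ * ‖v‖ : ℝ) : 𝕂)⁻¹) • v := rfl

theorem normOmega_ne_zero_iff (e v : Vec 𝕂 m) (hv : v ≠ 0) :
    normOmega e (Projectivization.mk 𝕂 v hv) ≠ 0 ↔ omega v e ≠ 0 := by
  simp [normOmega_mk, hv]

theorem norm_normalizedRep {e : Vec 𝕂 m} {ℓ : ℙ 𝕂 (Vec 𝕂 m)} (h : normOmega e ℓ ≠ 0) :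
    ‖normalizedRep e ℓ‖ = 1 := by
  induction ℓ with | h v hv => ?_
  have h0 := norm_ne_zero_iff.2 ((normOmega_ne_zero_iff e v hv).1 h)
  have h1 := norm_ne_zero_iff.2 hv
  rw [normalizedRep_mk, norm_smul, norm_mul, norm_inv, RCLike.norm_ofReal, norm_star,
    abs_of_nonneg (by positivity)]
  field_simp

theorem submodule_eq_span_normalizedRep {e : Vec 𝕂 m} {ℓ : ℙ 𝕂 (Vec 𝕂 m)}
    (h : normOmega e ℓ ≠ 0) : ℓ.submodule = 𝕂 ∙ normalizedRep e ℓ := by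
  have h2 : normalizedRep e ℓ ≠ 0 := norm_ne_zero_iff.1 (by rw [norm_normalizedRep h]; simp)
  induction ℓ with | h v hv => ?_
  rw [normalizedRep_mk] at h2 ⊢
  rw [Submodule.span_singleton_smul_eq (smul_ne_zero_iff.1 h2).1.isUnit,
    Projectivization.submodule_mk]

theorem continuousOn_normalizedRep (e : Vec 𝕂 m) :
    ContinuousOn (normalizedRep e) {ℓ : ℙ 𝕂 (Vec 𝕂 m) | normOmega e ℓ ≠ 0} := by
  have hopen : IsOpen {ℓ : ℙ 𝕂 (Vec 𝕂 m) | normOmega e ℓ ≠ 0} :=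
    isOpen_ne.preimage (continuous_normOmega e)
  refine (continuousOn_open_iff hopen).2 fun s hs => isOpen_iff_isOpen_mk.2 ?_
  have hω : Continuous fun v : {v : Vec 𝕂 m // v ≠ 0} => omega v.1 e :=
    (continuous_omega_left e).comp continuous_subtype_val
  have hc : ContinuousOn (fun v : {v : Vec 𝕂 m // v ≠ 0} =>
      (star (omega v.1 e) * ((‖omega v.1 e‖ * ‖v.1‖ : ℝ) : 𝕂)⁻¹) • v.1)
      {v | omega v.1 e ≠ 0} := by
    refine ContinuousOn.smul (hω.star.continuousOn.mul (ContinuousOn.inv₀ ?_ ?_))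
      continuous_subtype_val.continuousOn
    · exact (RCLike.continuous_ofReal.comp
        (hω.norm.mul continuous_subtype_val.norm)).continuousOn
    · intro v hv
      exact RCLike.ofReal_ne_zero.2 (mul_ne_zero (norm_ne_zero_iff.2 hv) (norm_ne_zero_iff.2 v.2))
  have := hc.isOpen_inter_preimage (isOpen_ne.preimage hω) hs
  convert this using 1
  ext v
  exact and_congr (normOmega_ne_zero_iff e v.1 v.2) Iff.rfl

end Projective

/-! ### Convergence of top lines and the doubling argument -/

section Dominated

variable {𝕂 : Type*} [RCLike 𝕂] {m : ℕ}

/-- The top lines along a path with exponential gaps converge exponentially fast. -/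
theorem norm_omega_top_sub_le (hm : 1 ≤ m) {g : ℕ → Matrix.symplecticGroup (Fin m) 𝕂}
    {u : ℕ → Vec 𝕂 m} (hu : ∀ n, IsTopVector (g n) (u n)) {M A r : ℝ} (hr : r < 1)
    (hM : ∀ n, sigma 1 ((g n)⁻¹ * g (n + 1)) ≤ M)
    (hA : ∀ n, sigma 2 (g n) ≤ A * r ^ n * sigma 1 (g n)) {z : Vec 𝕂 m} (hz : ‖z‖ = 1) {L : ℝ}
    (hL : Tendsto (fun n => ‖omega (u n) z‖) atTop (𝓝 L)) (n : ℕ) :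
    ‖omega (u n) z‖ ≤ L + 2 * M ^ 2 * A / (1 - r) * r ^ n := by
  have hstep : ∀ n, dist ‖omega (u n) z‖ ‖omega (u (n + 1)) z‖ ≤ 2 * M ^ 2 * A * r ^ n := by
    intro n
    rw [dist_comm, Real.dist_eq, mul_assoc _ A]
    refine (hu n).abs_norm_omega_sub_le hm (h := (g n)⁻¹ * g (n + 1)) ?_ (hM n) (hA n) hz
    rw [mul_inv_cancel_left]
    exact hu (n + 1)
  -- Sum the geometric tail of the successive differences.
  have h := dist_le_of_le_geometric_of_tendsto r _ hr hstep hL n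
  rw [Real.dist_eq] at h
  have h' := le_of_abs_le h
  rw [mul_div_right_comm] at h'
  linarith

/-- Along a path of uniformly bounded steps in the symplectic group, the forward and backward top
lines cannot be uniformly exponentially close to being `omega`-orthogonal. -/
theorem not_forall_norm_omega_top_le (hm : 1 ≤ m) {p : ℤ → Matrix.symplecticGroup (Fin m) 𝕂}
    {u : Matrix.symplecticGroup (Fin m) 𝕂 → Vec 𝕂 m} (hu : ∀ g, IsTopVector g (u g))
    {M A K q : ℝ} (hq0 : 0 < q) (hq : q < 1)
    (hM : ∀ i, sigma 1 ((p i)⁻¹ * p (i + 1)) ≤ M)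
    (hA : ∀ (i : ℤ) (n : ℕ), sigma 2 ((p i)⁻¹ * p (i + n)) ≤
      A * q ^ (4 * n) * sigma 1 ((p i)⁻¹ * p (i + n)))
    (hA' : ∀ (i : ℤ) (n : ℕ), sigma 2 ((p i)⁻¹ * p (i - n)) ≤
      A * q ^ (4 * n) * sigma 1 ((p i)⁻¹ * p (i - n)))
    (hK : ∀ (i : ℤ) (n : ℕ), ‖omega (u ((p i)⁻¹ * p (i + n))) (u ((p i)⁻¹ * p (i - n)))‖ ≤
      K * q ^ (4 * n)) : False := by
  have hM1 : 1 ≤ M := (one_le_sigma_one hm _).trans (hM 0)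
  have hpow : ∀ (n : ℕ) (i : ℤ), sigma 1 ((p i)⁻¹ * p (i + n)) ≤ M ^ n := by
    intro n
    induction n with
    | zero =>
      intro i
      have h1 : ∀ v : Vec 𝕂 m, linMap ((p i)⁻¹ * p (i + (0 : ℕ))) v = v := fun v => by
        simp [linMap_one]
      obtain ⟨v, hv, hgv, -⟩ := exists_norm_linMap_eq hm ((p i)⁻¹ * p (i + (0 : ℕ)))
      rw [← hgv, h1, hv, pow_zero]
    | succ n ih =>
      intro i
      have := sigma_one_mul_le hm ((p i)⁻¹ * p (i + n)) ((p (i + n))⁻¹ * p (i + n + 1))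
      rw [mul_assoc, mul_inv_cancel_left] at this
      push_cast
      rw [← add_assoc, pow_succ]
      exact this.trans (mul_le_mul (ih i) (hM _) (sigma_nonneg _ _) (by positivity))
  have hdouble : ∀ (n : ℕ) (i : ℤ), sigma 1 ((p i)⁻¹ * p (i + (2 * n : ℕ))) ≤
      sigma 1 ((p i)⁻¹ * p (i + n)) * sigma 1 ((p (i + n))⁻¹ * p (i + n + n)) *
        ((K + 2 * A) * q ^ (4 * n)) := by
    intro n i
    -- Split at the midpoint `i + n`: the inverse of the first half is the backward segment from
    -- there, so `hK` at `i + n` controls the pairing.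
    have h := IsTopVector.sigma_one_mul_le hm (g := (p i)⁻¹ * p (i + n))
      (h := (p (i + n))⁻¹ * p (i + n + n)) (hu _) (hu _) (hA (i + n) n) (κ' := A * q ^ (4 * n)) (by
        have := hA' (i + n) n
        rw [add_sub_cancel_right] at this
        rwa [mul_inv_rev, inv_inv])
    have h2 := hK (i + n) n
    rw [add_sub_cancel_right] at h2
    rw [mul_assoc, mul_inv_cancel_left, mul_inv_rev, inv_inv] at h
    rw [show i + ((2 * n : ℕ) : ℤ) = i + n + n by push_cast; ring]
    refine h.trans (mul_le_mul_of_nonneg_left (by linarith)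
      (mul_nonneg (sigma_nonneg _ _) (sigma_nonneg _ _)))
  -- Half of the decay `q ^ (4 * n)` absorbs the constants. The remaining `q ^ (2 * n)` is one
  -- factor `q` per step of the doubled segment.
  obtain ⟨N, hN⟩ : ∃ N : ℕ, ∀ n ≥ N, (K + 2 * A) * q ^ (2 * n) ≤ 1 := by
    have h0 : Tendsto (fun n : ℕ => (K + 2 * A) * q ^ (2 * n)) atTop (𝓝 ((K + 2 * A) * 0)) := by
      refine Tendsto.const_mul _ ((tendsto_pow_atTop_nhds_zero_of_lt_one hq0.le hq).comp ?_)
      exact tendsto_id.const_mul_atTop' two_pos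
    rw [mul_zero] at h0
    exact eventually_atTop.1 (h0.eventually (ge_mem_nhds one_pos))
  -- Each doubling improves the growth rate per step by `q`. Starting from `N + 1` keeps the length
  -- positive, as the final strict inequality requires.
  have hiter : ∀ (k : ℕ) (i : ℤ), sigma 1 ((p i)⁻¹ * p (i + ((N + 1) * 2 ^ k : ℕ))) ≤
      (M * q ^ k) ^ ((N + 1) * 2 ^ k) := by
    intro k
    induction k with
    | zero => intro i; simpa using hpow (N + 1) i
    | succ k ih =>
      intro i
      set n := (N + 1) * 2 ^ k with hn
      have hnN : N ≤ n := by
        have : 1 ≤ 2 ^ k := Nat.one_le_two_pow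
        nlinarith
      rw [show (N + 1) * 2 ^ (k + 1) = 2 * n by rw [hn, pow_succ]; ring]
      have hb : 0 ≤ (M * q ^ k) ^ n := by positivity
      calc _ ≤ _ := hdouble n i
        _ ≤ ((M * q ^ k) ^ n * (M * q ^ k) ^ n) * (q ^ (2 * n)) := by
          have h3 : (K + 2 * A) * q ^ (4 * n) ≤ q ^ (2 * n) := by
            have := mul_le_mul_of_nonneg_right (hN n hnN) (by positivity : 0 ≤ q ^ (2 * n))
            rw [show 4 * n = 2 * n + 2 * n by ring, pow_add]
            linarith
          have h4 := mul_le_mul (ih i) (ih (i + n)) (sigma_nonneg _ _) hb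
          exact (mul_le_mul_of_nonneg_left h3
            (mul_nonneg (sigma_nonneg _ _) (sigma_nonneg _ _))).trans
            (mul_le_mul_of_nonneg_right h4 (by positivity))
        _ = (M * q ^ (k + 1)) ^ (2 * n) := by
          rw [← pow_add, ← two_mul, ← mul_pow, pow_succ, mul_assoc]
  obtain ⟨k, hk⟩ : ∃ k : ℕ, M * q ^ k < 1 := by
    have h0 : Tendsto (fun k : ℕ => M * q ^ k) atTop (𝓝 (M * 0)) :=
      (tendsto_pow_atTop_nhds_zero_of_lt_one hq0.le hq).const_mul _
    rw [mul_zero] at h0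
    exact (h0.eventually (gt_mem_nhds one_pos)).exists
  have h5 := (one_le_sigma_one hm _).trans (hiter k 0)
  exact absurd h5 (not_le.2 (pow_lt_one₀ (by positivity) hk (by positivity)))

end Dominated

/-! ### Transversality of the limit map -/

section Transversality

variable {Γ : Type*} [Group Γ] {S : Set Γ} {𝕂 : Type*} [RCLike 𝕂] {m : ℕ}
  {ρ : Γ →* Matrix.symplecticGroup (Fin m) 𝕂} {ξ : Boundary S → ℙ 𝕂 (Vec 𝕂 m)}

theorem IsOneAnosov.exists_sigma_two_le (hρ : IsOneAnosov S ρ) :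
    ∃ c μ : ℝ, 0 < c ∧ 0 < μ ∧
      ∀ γ, sigma 2 (ρ γ) ≤ c * Real.exp (-(μ * wordLength S γ)) * sigma 1 (ρ γ) := by
  obtain ⟨c, μ, hc, hμ, h⟩ := hρ
  refine ⟨c⁻¹, μ, inv_pos.2 hc, hμ, fun γ => ?_⟩
  have h1 : 0 < c * Real.exp (μ * wordLength S γ) := by positivity
  -- If `sigma 2` were zero, the quotient would be zero by convention, against the positive lower
  -- bound.
  have h2 : 0 < sigma 2 (ρ γ) := by
    refine (sigma_nonneg _ _).lt_of_ne fun h0 => ?_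
    have := h γ
    rw [← h0, div_zero] at this
    linarith
  have h3 := (le_div_iff₀ h2).1 (h γ)
  rw [Real.exp_neg, ← mul_inv, ← div_eq_inv_mul, le_div_iff₀ h1]
  linarith

theorem IsLimitMap.tendsto_norm_omega (hm : 1 ≤ m) (hξ : IsLimitMap S ρ ξ)
    {u : Matrix.symplecticGroup (Fin m) 𝕂 → Vec 𝕂 m} (hu : ∀ g, IsTopVector g (u g))
    (r : GeodesicRay S) (z : Vec 𝕂 m) :
    Tendsto (fun n => ‖omega (u (ρ (r.1 n))) z‖) atTop (𝓝 (normOmega z (ξ (endpoint r)))) := by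
  have h := hξ.tendsto r (fun n => Projectivization.mk 𝕂 (u (ρ (r.1 n))) (hu _).ne_zero)
    (fun n => (hu _).isTopLine hm)
  have h2 := ((continuous_normOmega z).tendsto _).comp h
  refine h2.congr fun n => ?_
  rw [Function.comp_apply, normOmega_mk, (hu _).1, div_one]

theorem IsLimitMap.tendsto_norm_omega_inv_mul (hm : 1 ≤ m) (hξ : IsLimitMap S ρ ξ)
    {u : Matrix.symplecticGroup (Fin m) 𝕂 → Vec 𝕂 m} (hu : ∀ g, IsTopVector g (u g))
    (r : GeodesicRay S) (g : Γ) (z : Vec 𝕂 m) :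
    Tendsto (fun n => ‖omega (u ((ρ g)⁻¹ * ρ (r.1 n))) z‖) atTop
      (𝓝 (normOmega z (ξ (boundaryAct g⁻¹ (endpoint r))))) := by
  have h := hξ.tendsto_norm_omega hm hu (r.translate g⁻¹) z
  refine h.congr fun n => ?_
  rw [GeodesicRay.translate, map_mul, map_inv]

/-- Equivariance and invariance of `omega` carry orthogonality at one pair to all its translates,
hence to every basepoint on the path. -/
theorem IsLimitMap.omega_boundaryAct_eq_zero (hξ : IsLimitMap S ρ ξ) (g : Γ) {x y : Boundary S}
    {e f e' f' : Vec 𝕂 m} (hex : (ξ x).submodule = 𝕂 ∙ e) (hfy : (ξ y).submodule = 𝕂 ∙ f)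
    (he' : (ξ (boundaryAct g x)).submodule = 𝕂 ∙ e')
    (hf' : (ξ (boundaryAct g y)).submodule = 𝕂 ∙ f') (h : omega e f = 0) : omega e' f' = 0 := by
  rw [hξ.equivariant, hex, Submodule.map_span, Set.image_singleton] at he'
  rw [hξ.equivariant, hfy, Submodule.map_span, Set.image_singleton] at hf'
  obtain ⟨a, rfl⟩ := Submodule.mem_span_singleton.1 (he' ▸ Submodule.mem_span_singleton_self e')
  obtain ⟨b, rfl⟩ := Submodule.mem_span_singleton.1 (hf' ▸ Submodule.mem_span_singleton_self f')
  rw [omega_smul_left, omega_smul_right, omega_linMap, h, mul_zero, mul_zero]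

/-- Transversality of the limit map. -/
theorem IsLimitMap.omega_ne_zero (hS : IsWordHyperbolic S) (hm : 1 ≤ m) (hρ : IsOneAnosov S ρ)
    (hξ : IsLimitMap S ρ ξ) {x y : Boundary S} (hxy : x ≠ y) {e f : Vec 𝕂 m}
    (he : (ξ x).submodule = 𝕂 ∙ e) (hf : (ξ y).submodule = 𝕂 ∙ f) : omega e f ≠ 0 := by
  intro h0
  obtain ⟨r₁, rfl⟩ : ∃ r, endpoint r = x := Quotient.exists_rep x
  obtain ⟨r₂, rfl⟩ : ∃ r, endpoint r = y := Quotient.exists_rep y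
  choose u hu using exists_isTopVector (𝕂 := 𝕂) hm
  obtain ⟨c, μ, hc, hμ, hgap⟩ := hρ.exists_sigma_two_le
  obtain ⟨C, hC⟩ := hS.exists_sub_le_wordDist_rayConcat hxy
  set γ := rayConcat r₁ r₂ with hγ
  set p : ℤ → Matrix.symplecticGroup (Fin m) 𝕂 := fun i => ρ (γ i) with hp
  -- The quarter makes `q ^ (4 * n)` equal to the Anosov decay `exp (-(μ * n))`.
  set q := Real.exp (-(μ / 4)) with hq
  have hq0 : 0 < q := Real.exp_pos _
  have hq1 : q < 1 := (Real.exp_lt_exp.2 (by linarith : -(μ / 4) < 0)).trans_eq Real.exp_zero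
  have hr1 : q ^ 4 < 1 := pow_lt_one₀ hq0.le hq1 (by norm_num)
  have hqn : ∀ n : ℕ, q ^ (4 * n) = Real.exp (-(μ * n)) := fun n => by
    rw [hq, ← Real.exp_nat_mul]; congr 1; push_cast; ring
  set A := c * Real.exp (μ * C) with hAdef
  have hAij : ∀ (i j : ℤ) (n : ℕ), |(i : ℝ) - j| = n →
      sigma 2 ((p i)⁻¹ * p j) ≤ A * q ^ (4 * n) * sigma 1 ((p i)⁻¹ * p j) := by
    intro i j n hn
    have h := hgap ((γ i)⁻¹ * γ j)
    rw [map_mul, map_inv, wordLength_inv_mul] at h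
    refine h.trans (mul_le_mul_of_nonneg_right ?_ (sigma_nonneg _ _))
    rw [hqn, hAdef, mul_assoc, ← Real.exp_add]
    gcongr
    have := hC i j
    rw [hn] at this
    nlinarith
  have hA : ∀ (i : ℤ) (n : ℕ), sigma 2 ((p i)⁻¹ * p (i + n)) ≤
      A * q ^ (4 * n) * sigma 1 ((p i)⁻¹ * p (i + n)) := fun i n => hAij _ _ _ (by simp)
  have hA' : ∀ (i : ℤ) (n : ℕ), sigma 2 ((p i)⁻¹ * p (i - n)) ≤
      A * q ^ (4 * n) * sigma 1 ((p i)⁻¹ * p (i - n)) := fun i n => hAij _ _ _ (by simp)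
  obtain ⟨M, hM⟩ : ∃ M, ∀ i, sigma 1 ((p i)⁻¹ * p (i + 1)) ≤ M := by
    obtain ⟨B, hB⟩ := (hS.finite.image fun s => sigma 1 (ρ s)).bddAbove
    refine ⟨max B (sigma 1 (ρ ((r₂.1 0)⁻¹ * r₁.1 0))), fun i => ?_⟩
    rw [← map_inv, ← map_mul]
    rcases inv_mul_rayConcat_mem r₁ r₂ i with h | h | h
    · exact (hB ⟨_, h, rfl⟩).trans (le_max_left _ _)
    · rw [← sigma_one_inv hm, ← map_inv]
      exact (hB ⟨_, h, rfl⟩).trans (le_max_left _ _)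
    · rw [← h]
      exact le_max_right _ _
  have hM' : ∀ i, sigma 1 ((p (i + 1))⁻¹ * p i) ≤ M := fun i => by
    rw [← sigma_one_inv hm, mul_inv_rev, inv_inv]
    exact hM i
  -- The error term does not depend on `i`, because `M` and `A` are uniform along the path.
  have hfwd : ∀ (i : ℤ) (z : Vec 𝕂 m), ‖z‖ = 1 → ∀ n : ℕ, ‖omega (u ((p i)⁻¹ * p (i + n))) z‖ ≤
      normOmega z (ξ (boundaryAct (γ i)⁻¹ (endpoint r₁))) +
        2 * M ^ 2 * A / (1 - q ^ 4) * (q ^ 4) ^ n := by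
    intro i z hz n
    refine norm_omega_top_sub_le hm (g := fun n : ℕ => (p i)⁻¹ * p (i + n)) (fun n => hu _) hr1
      (fun n => ?_) (fun n => ?_) hz ?_ n
    · have := hM (i + n)
      simp only [mul_inv_rev, inv_inv, mul_assoc, mul_inv_cancel_left]
      push_cast
      rwa [← add_assoc]
    · rw [← pow_mul]
      exact hA i n
    · have h := hξ.tendsto_norm_omega_inv_mul hm hu r₁ (γ i) z
      -- For negative `i` the path reaches `r₁` only once `i + n ≥ 0`; truncation below that does
      -- not affect the limit.
      have ht : Tendsto (fun n : ℕ => (i + n).toNat) atTop atTop :=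
        tendsto_atTop.2 fun b => eventually_atTop.2 ⟨b + i.natAbs, fun n hn => by omega⟩
      refine (h.comp ht).congr' (eventually_atTop.2 ⟨i.natAbs, fun n hn => ?_⟩)
      have : γ (i + n) = r₁.1 (i + n).toNat := by
        rw [← rayConcat_natCast r₁ r₂, Int.toNat_of_nonneg (by omega)]
      simp only [Function.comp_apply, hp, this]
  have hbwd : ∀ (i : ℤ) (z : Vec 𝕂 m), ‖z‖ = 1 → ∀ n : ℕ, ‖omega (u ((p i)⁻¹ * p (i - n))) z‖ ≤
      normOmega z (ξ (boundaryAct (γ i)⁻¹ (endpoint r₂))) +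
        2 * M ^ 2 * A / (1 - q ^ 4) * (q ^ 4) ^ n := by
    intro i z hz n
    refine norm_omega_top_sub_le hm (g := fun n : ℕ => (p i)⁻¹ * p (i - n)) (fun n => hu _) hr1
      (fun n => ?_) (fun n => ?_) hz ?_ n
    · have := hM' (i - n - 1)
      simp only [mul_inv_rev, inv_inv, mul_assoc, mul_inv_cancel_left]
      push_cast
      rwa [sub_add_cancel, sub_sub] at this
    · rw [← pow_mul]
      exact hA' i n
    · have h := hξ.tendsto_norm_omega_inv_mul hm hu r₂ (γ i) z
      have ht : Tendsto (fun n : ℕ => (n - i - 1).toNat) atTop atTop :=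
        tendsto_atTop.2 fun b => eventually_atTop.2 ⟨b + i.natAbs + 1, fun n hn => by omega⟩
      refine (h.comp ht).congr' (eventually_atTop.2 ⟨i.natAbs + 1, fun n hn => ?_⟩)
      have : γ (i - n) = r₂.1 (n - i - 1).toNat := by
        rw [← rayConcat_negSucc r₁ r₂, Int.negSucc_eq, Int.toNat_of_nonneg (by omega)]
        congr 1
        ring
      simp only [Function.comp_apply, hp, this]
  refine not_forall_norm_omega_top_le hm hu hq0 hq1 hM hA hA'
    (K := 2 * (2 * M ^ 2 * A / (1 - q ^ 4))) fun i n => ?_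
  obtain ⟨e', he'1, he'⟩ := exists_unit_submodule_eq (ξ (boundaryAct (γ i)⁻¹ (endpoint r₁)))
  obtain ⟨f', hf'1, hf'⟩ := exists_unit_submodule_eq (ξ (boundaryAct (γ i)⁻¹ (endpoint r₂)))
  -- Replace the forward top vector by `e'`, then the backward one by `f'`. Each costs one error
  -- term, hence the 2 in `K`, and `omega f' e'` vanishes.
  have h1 := hfwd i (u ((p i)⁻¹ * p (i - n))) (hu _).1 n
  have h2 := hbwd i e' he'1 n
  rw [normOmega_eq_of_submodule_eq he'1 he', omega_swap e', norm_neg] at h1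
  rw [normOmega_eq_of_submodule_eq hf'1 hf', omega_swap f',
    hξ.omega_boundaryAct_eq_zero (γ i)⁻¹ he hf he' hf' h0, neg_zero, norm_zero] at h2
  rw [pow_mul]
  linarith

end Transversality

end AnosovSymplectic

end
-- The lift normalized by the line over the removed point
open AnosovSymplectic in
theorem proposition2p2 {𝕂 : Type*} [RCLike 𝕂] {Γ : Type*} [Group Γ] (S : Set Γ)
    (hS : IsWordHyperbolic S) (hΓ : ¬ IsElementary Γ) (w₀ : Boundary S)
    (m : ℕ) (hm : 1 ≤ m) (ρ : Γ →* Matrix.symplecticGroup (Fin m) 𝕂)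
    (hρ : IsOneAnosov S ρ) (ξ : Boundary S → ℙ 𝕂 (Vec 𝕂 m)) (hξ : IsLimitMap S ρ ξ) :
    ∃ ξ' : {x : Boundary S // x ≠ w₀} → Metric.sphere (0 : Vec 𝕂 m) 1,
      Continuous ξ' ∧
      (∀ x, (ξ x.1).submodule = 𝕂 ∙ (ξ' x : Vec 𝕂 m)) ∧
      ∀ x y, x ≠ y → omega (ξ' x : Vec 𝕂 m) (ξ' y : Vec 𝕂 m) ≠ 0 := by
  obtain ⟨e, -, he⟩ := exists_unit_submodule_eq (ξ w₀)
  have hne : ∀ x : {x : Boundary S // x ≠ w₀}, normOmega e (ξ x.1) ≠ 0 := fun x => by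
    obtain ⟨v, hv1, hv⟩ := exists_unit_submodule_eq (ξ x.1)
    rw [normOmega_eq_of_submodule_eq hv1 hv]
    exact norm_ne_zero_iff.2 (hξ.omega_ne_zero hS hm hρ x.2 hv he)
  refine ⟨fun x => ⟨normalizedRep e (ξ x.1), by simpa using norm_normalizedRep (hne x)⟩, ?_,
    fun x => submodule_eq_span_normalizedRep (hne x), fun x y hxy => ?_⟩
  · exact ((continuousOn_normalizedRep e).comp_continuous
      (hξ.continuous.comp continuous_subtype_val) hne).subtype_mk _
  · exact hξ.omega_ne_zero hS hm hρ (fun h => hxy (Subtype.ext h))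
      (submodule_eq_span_normalizedRep (hne x)) (submodule_eq_span_normalizedRep (hne y))
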